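/- Let $d\ge 1$ and $s\ge 1$ be integers, let $\beta>-d-s$ be real and let $\lambda_0,\dots,\lambda_{s-1}>0$. Let $\mathbb V=\{(x,t)\in\mathbb R^d\times\mathbb R:\ \|x\|=t,\ 0\le t\le 1\}$ be the conic surface, with the measure $\mathsf m$ given by $$\int_{\mathbb V} f\,d\mathsf m=\int_0^1 t^{d-1}\int_{\mathbb S^{d-1}} f(t\xi,t)\,d\sigma(\xi)\,dt,$$ where $\sigma$ is the surface measure of the unit sphere $\mathbb S^{d-1}$ (counting measure if $d=1$), and let $\omega_d=\sigma(\mathbb S^{d-1})$. For functions $f(x,t)$ on $\mathbb R^d\times\mathbb R$, $\partial_t$ denotes the partial derivative in $t$ with $x$ held fixed. For $\alpha>-d$, $\gamma>-1$ put $w_{\alpha,\gamma}(t)=t^{\alpha}(1-t)^{\gamma}$ and $$\langle f,g\rangle_{\alpha,\gamma}=b_{\alpha,\gamma}\int_{\mathbb V} f g\, w_{\alpha,\gamma}(t)\,d\mathsf m,\qquad b_{\alpha,\gamma}=\frac1{\omega_d}\frac{\Gamma(\alpha+\gamma+d+1)}{\Gamma(\alpha+d)\Gamma(\gamma+1)}$$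 (so that $\langle 1,1\rangle_{\alpha,\gamma}=1$), and let $$\langle f,g\rangle_{\beta,-s}=\frac1{\omega_d}\int_{\mathbb V}\partial_t^s f\,\partial_t^s g\;t^{\beta+s}\,d\mathsf m+\sum_{k=0}^{s-1}\frac{\lambda_k}{\omega_d}\int_{\mathbb S^{d-1}}\partial_t^k f(\xi,1)\,\partial_t^k g(\xi,1)\,d\sigma(\xi).$$ Let $\Pi_n$ be the linear span of the functions $(x,t)\mapsto t^jY(x)$, where $Y$ is a solid harmonic (a homogeneous polynomial on $\mathbb R^d$ with $\Delta Y=0$) of degree $m$ and $j+m\le n$; these are the representatives, harmonic in $x$, of the polynomials of degree at most $n$ on $\mathbb V$, that is, modulo the ideal generated by $t^2-\|x\|^2$. For each of the two forms, the space of orthogonal polynomials of degree $n$ consists of the $P\in\Pi_n$ that are orthogonal to $\Pi_k$ for all $k<n$, and $\operatorname{proj}_n^{\beta,-s}$, respectively $\operatorname{proj}_n^{\alpha,\gamma}$, denotes the orthogonal projection onto this space: $P=\operatorname{proj}_n f$ means that $P$ is in the space and $f-P$ is orthogonal to it. Let $f:\mathbb R^d\times\mathbb R\to\mathbb R$ be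 $s$ times differentiable in $t$ on an open set containing $\mathbb V\setminus\{(0,0)\}$, with $\partial_t^s f\in L^2(\mathbb V,w_{\beta+s,0})$ and $\partial_t^k f(\cdot,1)\in L^2(\mathbb S^{d-1})$ for $0\le k<s$. Then, for every $n\ge s$, the projections $\operatorname{proj}_n^{\beta,-s}f$ and $\operatorname{proj}_{n-s}^{\beta+s,0}(\partial_t^s f)$ exist and are unique, and $$\partial_t^s\operatorname{proj}_n^{\beta,-s}f=\operatorname{proj}_{n-s}^{\beta+s,0}(\partial_t^s f),$$ as polynomials in $(x,t)$, and hence in particular on $\mathbb V$. -/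

import Mathlib

open MeasureTheory

noncomputable section

/-- Real-valued functions of `(x, t)` with `x ∈ ℝ^d` and `t ∈ ℝ`. -/
abbrev ConeFun (d : ℕ) : Type := EuclideanSpace ℝ (Fin d) × ℝ → ℝ

/-- The partial derivative `∂_t^k f`, taken in the last variable `t` with `x` held fixed. -/
def tDeriv {d : ℕ} (k : ℕ) (f : ConeFun d) : ConeFun d :=
  fun z => iteratedDeriv k (fun v : ℝ => f (z.1, v)) z.2

/-- `f` is `s` times differentiable in the variable `t` on some open set containing the conic
surface `{(x, t) : ‖x‖ = t, 0 < t ≤ 1}` (nothing is required at the apex). -/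
def TDifferentiableNearCone {d : ℕ} (s : ℕ) (f : ConeFun d) : Prop :=
  ∃ U : Set (EuclideanSpace ℝ (Fin d) × ℝ), IsOpen U ∧
    (∀ z : EuclideanSpace ℝ (Fin d) × ℝ, ‖z.1‖ = z.2 → 0 < z.2 → z.2 ≤ 1 → z ∈ U) ∧
    ∀ z ∈ U, ∀ k < s, DifferentiableAt ℝ (iteratedDeriv k (fun v : ℝ => f (z.1, v))) z.2

/-- The surface measure `σ` of the unit sphere of `ℝ^d`. -/
def sphereMeasure (d : ℕ) : Measure (Metric.sphere (0 : EuclideanSpace ℝ (Fin d)) 1) :=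
  (volume : Measure (EuclideanSpace ℝ (Fin d))).toSphere

/-- The surface area `ω_d` of the unit sphere of `ℝ^d`. -/
def sphereArea (d : ℕ) : ℝ := (sphereMeasure d).real Set.univ

/-- The measure `m` on the conic surface `‖x‖ = t`, `0 ≤ t ≤ 1`, regarded as a measure on
`ℝ^d × ℝ`: `∫ f dm = ∫_0^1 t^(d-1) ∫_{S^(d-1)} f(t ξ, t) dσ(ξ) dt`. -/
def coneMeasure (d : ℕ) : Measure (EuclideanSpace ℝ (Fin d) × ℝ) :=
  ((((volume : Measure ℝ).restrict (Set.Ioc 0 1)).withDensity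
      (fun t => ENNReal.ofReal (t ^ (d - 1)))).prod (sphereMeasure d)).map
    (fun p => (p.1 • (p.2 : EuclideanSpace ℝ (Fin d)), p.1))

/-- The Jacobi weight `w_{β,γ}(t) = t^β (1 - t)^γ`. -/
def jacobiWeight (β γ t : ℝ) : ℝ := t ^ β * (1 - t) ^ γ

/-- Membership in `L²(V, w_{β,γ})`, where `V` is the conic surface. -/
def MemL2Cone {d : ℕ} (β γ : ℝ) (f : ConeFun d) : Prop :=
  MemLp f 2 ((coneMeasure d).withDensity (fun z => ENNReal.ofReal (jacobiWeight β γ z.2)))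

/-- The constant `b_{β,γ}` that normalizes the weight `w_{β,γ}` on the conic surface. -/
def coneConst (d : ℕ) (β γ : ℝ) : ℝ :=
  (1 / sphereArea d) *
    (Real.Gamma (β + γ + d + 1) / (Real.Gamma (β + d) * Real.Gamma (γ + 1)))

/-- The inner product `⟨f, g⟩_{β,γ} = b_{β,γ} ∫_V f g w_{β,γ} dm`. -/
def coneInner {d : ℕ} (β γ : ℝ) (f g : ConeFun d) : ℝ :=
  coneConst d β γ * ∫ z, f z * g z * jacobiWeight β γ z.2 ∂(coneMeasure d)

/-- The Sobolev inner product
`⟨f, g⟩_{β,-s} = ω_d⁻¹ ∫_V ∂_t^s f ∂_t^s g t^(β+s) dm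
  + ∑_{k < s} (λ_k / ω_d) ∫_{S^(d-1)} ∂_t^k f(ξ, 1) ∂_t^k g(ξ, 1) dσ(ξ)`. -/
def sobolevInner {d : ℕ} (s : ℕ) (β : ℝ) (lam : ℕ → ℝ) (f g : ConeFun d) : ℝ :=
  (1 / sphereArea d) *
      (∫ z, tDeriv s f z * tDeriv s g z * z.2 ^ (β + (s : ℝ)) ∂(coneMeasure d)) +
    ∑ k ∈ Finset.range s, (lam k / sphereArea d) *
      ∫ ξ : Metric.sphere (0 : EuclideanSpace ℝ (Fin d)) 1,
        tDeriv k f ((ξ : EuclideanSpace ℝ (Fin d)), 1) *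
          tDeriv k g ((ξ : EuclideanSpace ℝ (Fin d)), 1) ∂(sphereMeasure d)

/-- `p` is a solid harmonic of degree `m`: homogeneous of degree `m` with `Δ p = 0`. -/
def IsSolidHarmonic {d : ℕ} (m : ℕ) (p : MvPolynomial (Fin d) ℝ) : Prop :=
  p.IsHomogeneous m ∧ ∑ i, MvPolynomial.pderiv i (MvPolynomial.pderiv i p) = 0

/-- The polynomials of degree at most `n` on the conic surface, i.e. polynomials in `(x, t)`
modulo the ideal generated by `t² - ‖x‖²`. Each class has exactly one representative of the form
`∑ t^j Y(x)` with solid harmonics `Y` (replace `‖x‖²` by `t²`), and classes are identified with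
these representatives; it is on them that `∂_t` acts, namely on the powers of `t` only. -/
def conePoly (d n : ℕ) : Submodule ℝ (ConeFun d) :=
  Submodule.span ℝ {g | ∃ (j m : ℕ) (p : MvPolynomial (Fin d) ℝ), j + m ≤ n ∧
    IsSolidHarmonic m p ∧ g = fun z => z.2 ^ j * MvPolynomial.eval (fun i => z.1 i) p}

/-- The space of orthogonal polynomials of degree `n` for a bilinear form `B`: the polynomials
of degree at most `n` on the conic surface that are orthogonal to all those of lower degree. -/
def orthPoly {d : ℕ} (B : ConeFun d → ConeFun d → ℝ) (n : ℕ) : Set (ConeFun d) :=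
  {P | P ∈ conePoly d n ∧ ∀ k < n, ∀ q ∈ conePoly d k, B P q = 0}

/-- `P` is the orthogonal projection of `f` onto the space of orthogonal polynomials of
degree `n` for `B`. -/
def IsOrthProj {d : ℕ} (B : ConeFun d → ConeFun d → ℝ) (n : ℕ) (f P : ConeFun d) : Prop :=
  P ∈ orthPoly B n ∧ ∀ g ∈ orthPoly B n, B (f - P) g = 0

/-- `P = proj_n^{β,γ} f`. -/
def IsConeProj {d : ℕ} (β γ : ℝ) (n : ℕ) (f P : ConeFun d) : Prop :=
  IsOrthProj (coneInner β γ) n f P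

/-- `P = proj_n^{β,-s} f`. -/
def IsSobolevProj {d : ℕ} (s : ℕ) (β : ℝ) (lam : ℕ → ℝ) (n : ℕ) (f P : ConeFun d) : Prop :=
  IsOrthProj (sobolevInner s β lam) n f P

end

/-!
The operator `∂_t^s` maps polynomials of degree `n` to polynomials of degree `n - s`, and every
polynomial of degree `n - s` has a preimage of degree `n` that vanishes to order `s` on the rim
`t = 1`. Against such a preimage the rim terms of the Sobolev form disappear, and the form reduces
to a constant multiple of the weighted `L²` form of the `s`-th derivatives. Orthogonality to lower
degrees and to the residual `f - P` therefore passes from one form to the other.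

Existence and uniqueness of the projections follow once both forms are definite on polynomials.
For fixed `t` a polynomial is harmonic in `x`, so by the maximum principle it is determined by its
values on the sphere `‖x‖ = t`; a polynomial vanishing almost everywhere on the cone thus vanishes
for `0 < t < 1` and all `x`, hence identically by analyticity in `t`. If `∂_t^s P = 0`, the same
argument on the rim kills the Taylor coefficients of `P` at `t = 1`.
-/

noncomputable section

open Filter (Tendsto)
open InnerProductSpace Laplacian

section MaximumPrinciple

theorem deriv_deriv_nonpos_of_isLocalMax {g : ℝ → ℝ} {a : ℝ} (h : IsLocalMax g a)
    (hg : ContinuousAt g a) : deriv (deriv g) a ≤ 0 := by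
  by_contra! hpos
  have hmin := isLocalMin_of_deriv_deriv_pos hpos h.deriv_eq_zero hg
  have hconst : g =ᶠ[nhds a] fun _ => g a := by
    filter_upwards [h, hmin] with y hle hge using le_antisymm hle hge
  simp [hconst.deriv.deriv_eq] at hpos

theorem iteratedFDeriv_two_apply_eq_deriv_deriv {E F : Type*} [NormedAddCommGroup E]
    [NormedSpace ℝ E] [NormedAddCommGroup F] [NormedSpace ℝ F] {f : E → F} {x : E}
    (hf : ContDiffAt ℝ 2 f x) (v : E) :
    iteratedFDeriv ℝ 2 f x ![v, v] = deriv (deriv fun τ : ℝ => f (x + τ • v)) 0 := by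
  have hline (τ : ℝ) : HasDerivAt (fun τ : ℝ => x + τ • v) v τ := by
    simpa using ((hasDerivAt_id τ).smul_const v).const_add x
  have hcont : Tendsto (fun τ : ℝ => x + τ • v) (nhds 0) (nhds x) := by
    simpa using (hline 0).continuousAt.tendsto
  have hderiv : deriv (fun τ : ℝ => f (x + τ • v)) =ᶠ[nhds 0]
      fun τ => fderiv ℝ f (x + τ • v) v := by
    filter_upwards [hcont.eventually (hf.eventually (by simp))] with τ hτ
    exact ((hτ.differentiableAt two_ne_zero).hasFDerivAt.comp_hasDerivAt τ (hline τ)).deriv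
  have hfderiv : HasFDerivAt (fderiv ℝ f) (fderiv ℝ (fderiv ℝ f) x) (x + (0 : ℝ) • v) := by
    simpa using ((hf.fderiv_right (m := 1) le_rfl).differentiableAt one_ne_zero).hasFDerivAt
  have hderiv₂ : deriv (fun τ : ℝ => fderiv ℝ f (x + τ • v) v) 0 = fderiv ℝ (fderiv ℝ f) x v v :=
    ((ContinuousLinearMap.apply ℝ F v).hasFDerivAt.comp_hasDerivAt 0
      (hfderiv.comp_hasDerivAt 0 (hline 0))).deriv
  rw [hderiv.deriv_eq, hderiv₂]
  exact iteratedFDeriv_two_apply f x ![v, v]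

variable {E : Type*} [NormedAddCommGroup E] [InnerProductSpace ℝ E] [FiniteDimensional ℝ E]
  {f : E → ℝ} {U : Set E} {x : E}

theorem laplacian_eq_sum_deriv_deriv {ι : Type*} [Fintype ι] (b : OrthonormalBasis ι ℝ E)
    (hf : ContDiffAt ℝ 2 f x) :
    Δ f x = ∑ i, deriv (deriv fun τ : ℝ => f (x + τ • b i)) 0 := by
  simp only [laplacian_eq_iteratedFDeriv_orthonormalBasis f b,
    iteratedFDeriv_two_apply_eq_deriv_deriv hf]

theorem laplacian_nonpos_of_isLocalMax (hf : ContDiffAt ℝ 2 f x) (h : IsLocalMax f x) :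
    Δ f x ≤ 0 := by
  rw [laplacian_eq_sum_deriv_deriv (stdOrthonormalBasis ℝ E) hf]
  refine Finset.sum_nonpos fun i _ => ?_
  set line := fun τ : ℝ => x + τ • stdOrthonormalBasis ℝ E i
  have hline : ContinuousAt line 0 := by fun_prop
  have hline₀ : line 0 = x := by simp [line]
  rw [← hline₀] at h hf
  exact deriv_deriv_nonpos_of_isLocalMax (h.comp_continuous hline) (hf.continuousAt.comp hline)

theorem laplacian_norm_sq (x : E) : Δ (fun y : E => ‖y‖ ^ 2) x = 2 * Module.finrank ℝ E := by
  have hdd (i) : deriv (deriv fun τ : ℝ => ‖x + τ • stdOrthonormalBasis ℝ E i‖ ^ 2) 0 = 2 := by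
    have hsq (τ : ℝ) : ‖x + τ • stdOrthonormalBasis ℝ E i‖ ^ 2 =
        ‖x‖ ^ 2 + 2 * inner ℝ x (stdOrthonormalBasis ℝ E i) * τ + τ ^ 2 := by
      simp only [norm_add_sq_real, inner_smul_right, norm_smul, OrthonormalBasis.norm_eq_one,
        Real.norm_eq_abs, mul_one, sq_abs]
      ring
    have hd (τ : ℝ) := (((hasDerivAt_id' τ).const_mul
      (2 * inner ℝ x (stdOrthonormalBasis ℝ E i))).const_add (‖x‖ ^ 2)).fun_add (hasDerivAt_pow 2 τ)
    simp only [hsq, funext fun τ => (hd τ).deriv]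
    simp
  rw [laplacian_eq_sum_deriv_deriv (stdOrthonormalBasis ℝ E) (contDiff_norm_sq ℝ).contDiffAt]
  simp [hdd, mul_comm]

theorem exists_mem_frontier_le_of_laplacian_pos (hU : IsOpen U) (hUb : Bornology.IsBounded U)
    (hfc : ContinuousOn f (closure U)) (hf : ∀ y ∈ U, ContDiffAt ℝ 2 f y)
    (hΔ : ∀ y ∈ U, 0 < Δ f y) (hx : x ∈ closure U) : ∃ y ∈ frontier U, f x ≤ f y := by
  obtain ⟨y, hy, hmax⟩ := hUb.isCompact_closure.exists_isMaxOn ⟨x, hx⟩ hfc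
  refine ⟨y, ⟨hy, fun hyU => ?_⟩, hmax hx⟩
  rw [hU.interior_eq] at hyU
  exact (hΔ y hyU).not_ge (laplacian_nonpos_of_isLocalMax (hf y hyU)
    (hmax.isLocalMax (Filter.mem_of_superset (hU.mem_nhds hyU) subset_closure)))

theorem le_of_harmonicContOnCl_of_le_frontier [Nontrivial E] {c : ℝ} (hf : HarmonicContOnCl f U)
    (hU : IsOpen U) (hUb : Bornology.IsBounded U) (hc : ∀ y ∈ frontier U, f y ≤ c)
    (hx : x ∈ closure U) : f x ≤ c := by
  obtain ⟨R, hR⟩ := hUb.closure.exists_norm_le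
  -- Perturbing `f` to `f + ε ‖·‖²` makes its Laplacian strictly positive.
  have hperturbed (ε : ℝ) (hε : 0 < ε) : f x ≤ c + ε * R ^ 2 := by
    have hsq (y : E) : ContDiffAt ℝ 2 (ε • fun y : E => ‖y‖ ^ 2) y :=
      (contDiff_norm_sq ℝ).contDiffAt.const_smul ε
    have hΔ (y) (hy : y ∈ U) : 0 < Δ (f + ε • fun y : E => ‖y‖ ^ 2) y := by
      rw [(hf.1 y hy).1.laplacian_add (hsq y),
        laplacian_smul ε (contDiff_norm_sq ℝ).contDiffAt, laplacian_norm_sq,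
        (hf.1 y hy).2.eq_of_nhds]
      have : 0 < Module.finrank ℝ E := Module.finrank_pos
      simp only [Pi.zero_apply, zero_add, smul_eq_mul]
      positivity
    obtain ⟨y, hy, hxy⟩ := exists_mem_frontier_le_of_laplacian_pos hU hUb
      (hf.2.add (by fun_prop)) (fun y hy => (hf.1 y hy).1.add (hsq y)) hΔ hx
    have hyR : ‖y‖ ^ 2 ≤ R ^ 2 :=
      pow_le_pow_left₀ (norm_nonneg y) (hR y (frontier_subset_closure hy)) 2
    calc f x ≤ f x + ε * ‖x‖ ^ 2 := le_add_of_nonneg_right (by positivity)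
      _ ≤ f y + ε * ‖y‖ ^ 2 := hxy
      _ ≤ c + ε * R ^ 2 := by gcongr; exact hc y hy
  have hlim : Tendsto (fun ε : ℝ => c + ε * R ^ 2) (nhdsWithin 0 (Set.Ioi 0)) (nhds c) := by
    have hcont : Continuous fun ε : ℝ => c + ε * R ^ 2 := by fun_prop
    simpa using (hcont.tendsto 0).mono_left nhdsWithin_le_nhds
  exact ge_of_tendsto hlim (by filter_upwards [self_mem_nhdsWithin] with ε hε using hperturbed ε hε)

theorem eqOn_zero_of_harmonicContOnCl_of_eqOn_frontier [Nontrivial E] (hf : HarmonicContOnCl f U)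
    (hU : IsOpen U) (hUb : Bornology.IsBounded U) (h : Set.EqOn f 0 (frontier U)) :
    Set.EqOn f 0 (closure U) := by
  refine fun x hx => le_antisymm
    (le_of_harmonicContOnCl_of_le_frontier hf hU hUb (fun y hy => (h hy).le) hx) ?_
  have hle := le_of_harmonicContOnCl_of_le_frontier hf.neg hU hUb (c := 0)
    (fun y hy => by simp [h hy]) hx
  simpa using hle

theorem eq_zero_of_harmonicOnNhd_of_eqOn_sphere [Nontrivial E] (hf : HarmonicOnNhd f Set.univ)
    (hfa : AnalyticOnNhd ℝ f Set.univ) {r : ℝ} (hr : 0 < r)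
    (h : Set.EqOn f 0 (Metric.sphere x r)) : f = 0 := by
  have hcl : HarmonicContOnCl f (Metric.ball x r) :=
    ⟨fun y _ => hf y trivial, fun y _ => (hfa y trivial).continuousAt.continuousWithinAt⟩
  have hball := eqOn_zero_of_harmonicContOnCl_of_eqOn_frontier hcl Metric.isOpen_ball
    Metric.isBounded_ball (by rwa [frontier_ball x hr.ne'])
  exact hfa.eq_of_eventuallyEq analyticOnNhd_const (Filter.mem_of_superset
    (Metric.ball_mem_nhds x hr) (subset_closure.trans hball))

end MaximumPrinciple

section BilinearForms

/-- `B` restricts to a bilinear form on the subspace `A`. Nothing is asked of its values outside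
`A`, where a form given by an integral takes junk values. -/
def IsBilinOn {K V : Type*} [CommRing K] [AddCommGroup V] [Module K V] (B : V → V → K)
    (A : Submodule K V) : Prop :=
  ∃ Φ : LinearMap.BilinForm K A, ∀ f g : A, Φ f g = B f g

namespace IsBilinOn

variable {K V ι : Type*} [CommRing K] [AddCommGroup V] [Module K V] {B B₁ B₂ : V → V → K}
  {A : Submodule K V} {f g h : V}

theorem add_left (hB : IsBilinOn B A) (hf : f ∈ A) (hg : g ∈ A) (hh : h ∈ A) :
    B (f + g) h = B f h + B g h := by
  obtain ⟨Φ, hΦ⟩ := hB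
  simpa [hΦ] using LinearMap.map_add₂ Φ (⟨f, hf⟩ : A) ⟨g, hg⟩ ⟨h, hh⟩

theorem smul_left (hB : IsBilinOn B A) (c : K) (hf : f ∈ A) (hh : h ∈ A) :
    B (c • f) h = c * B f h := by
  obtain ⟨Φ, hΦ⟩ := hB
  simpa [hΦ] using LinearMap.map_smul₂ Φ c (⟨f, hf⟩ : A) ⟨h, hh⟩

theorem sub_left (hB : IsBilinOn B A) (hf : f ∈ A) (hg : g ∈ A) (hh : h ∈ A) :
    B (f - g) h = B f h - B g h := by
  obtain ⟨Φ, hΦ⟩ := hB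
  simpa only [hΦ, AddSubgroupClass.coe_sub] using LinearMap.map_sub₂ Φ (⟨f, hf⟩ : A) ⟨g, hg⟩ ⟨h, hh⟩

theorem zero_left (hB : IsBilinOn B A) (hh : h ∈ A) : B 0 h = 0 := by
  simpa using hB.smul_left 0 A.zero_mem hh

theorem add (h₁ : IsBilinOn B₁ A) (h₂ : IsBilinOn B₂ A) :
    IsBilinOn (fun f g => B₁ f g + B₂ f g) A := by
  obtain ⟨Φ₁, hΦ₁⟩ := h₁
  obtain ⟨Φ₂, hΦ₂⟩ := h₂
  exact ⟨Φ₁ + Φ₂, fun f g => by simp [hΦ₁, hΦ₂]⟩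

theorem const_mul (c : K) (hB : IsBilinOn B A) : IsBilinOn (fun f g => c * B f g) A := by
  obtain ⟨Φ, hΦ⟩ := hB
  exact ⟨c • Φ, fun f g => by simp [hΦ]⟩

theorem sum {t : Finset ι} {B : ι → V → V → K} (hB : ∀ i ∈ t, IsBilinOn (B i) A) :
    IsBilinOn (fun f g => ∑ i ∈ t, B i f g) A := by
  choose! Φ hΦ using hB
  exact ⟨∑ i ∈ t, Φ i, fun f g => by simpa using Finset.sum_congr rfl fun i hi => hΦ i hi f g⟩

theorem existsUnique_mem_forall_sub_eq_zero {K V : Type*} [Field K] [AddCommGroup V] [Module K V]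
    {B : V → V → K} {A : Submodule K V} {f : V} (hB : IsBilinOn B A) {U : Submodule K V}
    (hU : U ≤ A) [FiniteDimensional K U] (hpos : ∀ u ∈ U, B u u = 0 → u = 0) (hf : f ∈ A) :
    ∃! P, P ∈ U ∧ ∀ g ∈ U, B (f - P) g = 0 := by
  obtain ⟨Φ, hΦ⟩ := id hB
  let Ψ : LinearMap.BilinForm K U := Φ.compl₁₂ (U.inclusion hU) (U.inclusion hU)
  have hΨ (u v : U) : Ψ u v = B u v := hΦ _ _
  have hanisotropic (u : U) (hu : Ψ u u = 0) : u = 0 := Subtype.ext (hpos u u.2 (by rwa [hΨ] at hu))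
  have hnondeg : Ψ.Nondegenerate :=
    ⟨fun u hu => hanisotropic u (hu u), fun u hu => hanisotropic u (hu u)⟩
  let P := (Ψ.toDual hnondeg).symm ((Φ ⟨f, hf⟩).comp (U.inclusion hU))
  have hP (g : U) : B P g = B f g := by
    rw [← hΨ, LinearMap.BilinForm.apply_toDual_symm_apply (hB := hnondeg)]
    exact hΦ _ _
  refine ⟨P, ⟨P.2, fun g hg => ?_⟩, fun Q ⟨hQ, hfQ⟩ => ?_⟩
  · rw [hB.sub_left hf (hU P.2) (hU hg), hP ⟨g, hg⟩, sub_self]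
  · have hQP : Q - P ∈ U := U.sub_mem hQ P.2
    have hQg := hfQ _ hQP
    have hPg := hP ⟨Q - P, hQP⟩
    rw [hB.sub_left hf (hU hQ) (hU hQP)] at hQg
    refine sub_eq_zero.1 (hpos _ hQP ?_)
    rw [hB.sub_left (hU hQ) (hU P.2) (hU hQP)]
    linear_combination -hPg - hQg

end IsBilinOn

section Integral

variable {X V : Type*} [MeasurableSpace X] {μ : Measure X} [AddCommGroup V] [Module ℝ V]

theorem inner_toLp_eq_integral_mul {f g : X → ℝ} (hf : MemLp f 2 μ) (hg : MemLp g 2 μ) :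
    inner ℝ (hf.toLp f) (hg.toLp g) = ∫ x, f x * g x ∂μ := by
  rw [L2.inner_def]
  refine integral_congr_ae ?_
  filter_upwards [hf.coeFn_toLp, hg.coeFn_toLp] with x hfx hgx
  simp [hfx, hgx, mul_comm]

theorem isBilinOn_integral_mul {T : V → X → ℝ} {A : Submodule ℝ V}
    (hT : ∀ f ∈ A, MemLp (T f) 2 μ) (hadd : ∀ f ∈ A, ∀ g ∈ A, T (f + g) =ᵐ[μ] T f + T g)
    (hsmul : ∀ c : ℝ, ∀ f ∈ A, T (c • f) =ᵐ[μ] c • T f) :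
    IsBilinOn (fun f g => ∫ x, T f x * T g x ∂μ) A := by
  let toL2 : A →ₗ[ℝ] Lp ℝ 2 μ :=
    { toFun f := (hT f f.2).toLp
      map_add' f g := by
        rw [← MemLp.toLp_add]
        exact MemLp.toLp_congr _ _ (hadd f f.2 g g.2)
      map_smul' c f := by
        rw [RingHom.id_apply, ← MemLp.toLp_const_smul]
        exact MemLp.toLp_congr _ _ (hsmul c f f.2) }
  exact ⟨(innerₗ (Lp ℝ 2 μ)).compl₁₂ toL2 toL2,
    fun f g => inner_toLp_eq_integral_mul (hT f f.2) (hT g g.2)⟩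

theorem ae_eq_zero_of_integral_mul_self_eq_zero {f : X → ℝ} (hf : MemLp f 2 μ)
    (h : ∫ x, f x * f x ∂μ = 0) : f =ᵐ[μ] 0 := by
  rw [← inner_toLp_eq_integral_mul hf hf, inner_self_eq_zero] at h
  exact (hf.coeFn_toLp.symm.trans (by rw [h])).trans (Lp.coeFn_zero ..)

end Integral

end BilinearForms

section Projections

variable {d : ℕ} {B : ConeFun d → ConeFun d → ℝ} {A : Submodule ℝ (ConeFun d)}

theorem IsBilinOn.existsUnique_isOrthProj (hB : IsBilinOn B A) (hA : ∀ n, conePoly d n ≤ A)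
    {n : ℕ} [FiniteDimensional ℝ (conePoly d n)] (hpos : ∀ P ∈ conePoly d n, B P P = 0 → P = 0)
    {f : ConeFun d} (hf : f ∈ A) : ∃! P, IsOrthProj B n f P := by
  let U : Submodule ℝ (ConeFun d) :=
    { carrier := orthPoly B n
      zero_mem' := ⟨Submodule.zero_mem _, fun k _ q hq => hB.zero_left (hA k hq)⟩
      add_mem' {P Q} hP hQ := ⟨Submodule.add_mem _ hP.1 hQ.1, fun k hk q hq => by
        rw [hB.add_left (hA n hP.1) (hA n hQ.1) (hA k hq), hP.2 k hk q hq, hQ.2 k hk q hq,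
          add_zero]⟩
      smul_mem' c P hP := ⟨Submodule.smul_mem _ c hP.1, fun k hk q hq => by
        rw [hB.smul_left c (hA n hP.1) (hA k hq), hP.2 k hk q hq, mul_zero]⟩ }
  have hU : U ≤ conePoly d n := fun P hP => hP.1
  have : FiniteDimensional ℝ U := Submodule.finiteDimensional_of_le hU
  exact hB.existsUnique_mem_forall_sub_eq_zero (hU.trans (hA n)) (fun P hP => hpos P hP.1) hf

end Projections

section ConePolynomials

open MvPolynomial (eval pderiv)

section Harmonic

variable {ι : Type*}

theorem hasDerivAt_eval_add_smul_single [DecidableEq ι] (p : MvPolynomial ι ℝ) (x : ι → ℝ) (i : ι)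
    (τ : ℝ) : HasDerivAt (fun τ : ℝ => eval (x + τ • Pi.single i 1) p)
      (eval (x + τ • Pi.single i 1) (pderiv i p)) τ := by
  induction p using MvPolynomial.induction_on with
  | C a => simpa using hasDerivAt_const τ a
  | add p q hp hq => simpa only [map_add] using hp.fun_add hq
  | mul_X p j hp =>
    have hX : HasDerivAt (fun τ : ℝ => (x + τ • Pi.single i 1 : ι → ℝ) j)
        (eval (x + τ • Pi.single i 1) (pderiv i (MvPolynomial.X j))) τ := by
      have hcoord := ((hasDerivAt_id' τ).mul_const ((Pi.single i 1 : ι → ℝ) j)).const_add (x j)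
      rcases eq_or_ne j i with rfl | hji
      · simpa using hcoord
      · simpa [hji, MvPolynomial.pderiv_X_of_ne hji] using hcoord
    simpa [Derivation.leibniz, mul_comm, add_comm] using hp.fun_mul hX

variable [Fintype ι]

theorem analyticOnNhd_eval_euclideanSpace (p : MvPolynomial ι ℝ) :
    AnalyticOnNhd ℝ (fun x : EuclideanSpace ℝ ι => eval x p) Set.univ :=
  .eval_continuousLinearMap (EuclideanSpace.equiv ι ℝ : EuclideanSpace ℝ ι →L[ℝ] ι → ℝ) p

theorem laplacian_eval (p : MvPolynomial ι ℝ) :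
    Δ (fun x : EuclideanSpace ℝ ι => eval x p) =
      fun x : EuclideanSpace ℝ ι => eval x (∑ i, pderiv i (pderiv i p)) := by
  classical
  ext x
  have hderiv (q : MvPolynomial ι ℝ) (i) (τ : ℝ) := (hasDerivAt_eval_add_smul_single q x i τ).deriv
  rw [laplacian_eq_sum_deriv_deriv (EuclideanSpace.basisFun ι ℝ)
    (analyticOnNhd_eval_euclideanSpace p x trivial).contDiffAt, map_sum]
  refine Finset.sum_congr rfl fun i _ => ?_
  have := hderiv (pderiv i p) i 0
  simp_rw [← funext (hderiv p i)] at this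
  simpa using this

theorem harmonicOnNhd_eval_of_isSolidHarmonic {d m : ℕ} {p : MvPolynomial (Fin d) ℝ}
    (hp : IsSolidHarmonic m p) :
    HarmonicOnNhd (fun x : EuclideanSpace ℝ (Fin d) => eval x p) Set.univ := fun x _ =>
  ⟨(analyticOnNhd_eval_euclideanSpace p x trivial).contDiffAt,
    .of_forall fun y => by simp [laplacian_eval, hp.2]⟩

end Harmonic

variable {d n : ℕ} {P : ConeFun d}

/-- The function `(x, t) ↦ t ^ j * p(x)` on `ℝ^d × ℝ`, linear in the polynomial `p`. The spaces
`conePoly d n` are spanned by such functions with `p` a solid harmonic. -/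
def coneMonomial (j : ℕ) : MvPolynomial (Fin d) ℝ →ₗ[ℝ] ConeFun d where
  toFun p z := z.2 ^ j * eval z.1 p
  map_add' p q := by ext z; simp [mul_add]
  map_smul' c p := by ext z; simp [mul_left_comm]

theorem coneMonomial_mem_conePoly {j m : ℕ} {p : MvPolynomial (Fin d) ℝ}
    (hp : IsSolidHarmonic m p) (hjm : j + m ≤ n) : coneMonomial j p ∈ conePoly d n :=
  Submodule.subset_span ⟨j, m, p, hjm, hp, rfl⟩

theorem conePoly_induction {motive : (P : ConeFun d) → P ∈ conePoly d n → Prop}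
    (monomial : ∀ (j m : ℕ) (p : MvPolynomial (Fin d) ℝ) (hp : IsSolidHarmonic m p)
      (hjm : j + m ≤ n), motive (coneMonomial j p) (coneMonomial_mem_conePoly hp hjm))
    (zero : motive 0 (Submodule.zero_mem _))
    (add : ∀ P Q hP hQ, motive P hP → motive Q hQ → motive (P + Q) (Submodule.add_mem _ hP hQ))
    (smul : ∀ (c : ℝ) P hP, motive P hP → motive (c • P) (Submodule.smul_mem _ c hP))
    (hP : P ∈ conePoly d n) : motive P hP := by
  refine Submodule.span_induction ?_ zero add smul hP
  rintro _ ⟨j, m, p, hjm, hp, rfl⟩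
  exact monomial j m p hp hjm

instance finiteDimensional_conePoly (d n : ℕ) : FiniteDimensional ℝ (conePoly d n) := by
  have hle : conePoly d n ≤
      ⨆ j : Fin (n + 1), (MvPolynomial.restrictTotalDegree (Fin d) ℝ n).map (coneMonomial j) := by
    intro P hP
    induction hP using conePoly_induction with
    | monomial j m p hp hjm =>
      refine Submodule.mem_iSup_of_mem (⟨j, by omega⟩ : Fin (n + 1)) ⟨p, ?_, rfl⟩
      exact (MvPolynomial.mem_restrictTotalDegree _ _ _).2 (hp.1.totalDegree_le.trans (by omega))
    | zero => exact Submodule.zero_mem _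
    | add P Q _ _ hP hQ => exact Submodule.add_mem _ hP hQ
    | smul c P _ hP => exact Submodule.smul_mem _ c hP
  exact Submodule.finiteDimensional_of_le hle

theorem analyticOnNhd_of_mem_conePoly (hP : P ∈ conePoly d n) : AnalyticOnNhd ℝ P Set.univ := by
  induction hP using conePoly_induction with
  | monomial j _ p =>
    have hp : AnalyticOnNhd ℝ (fun z : EuclideanSpace ℝ (Fin d) × ℝ => eval z.1 p) Set.univ :=
      .eval_continuousLinearMap ((EuclideanSpace.equiv (Fin d) ℝ :
        EuclideanSpace ℝ (Fin d) →L[ℝ] Fin d → ℝ).comp (.fst ℝ _ ℝ)) p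
    exact (analyticOnNhd_snd.pow j).mul hp
  | zero => exact analyticOnNhd_const
  | add P Q _ _ hP hQ => exact hP.add hQ
  | smul c P _ hP => exact hP.const_smul

theorem contDiff_of_mem_conePoly (hP : P ∈ conePoly d n) {k : WithTop ℕ∞} : ContDiff ℝ k P :=
  (analyticOnNhd_of_mem_conePoly hP).contDiff

theorem continuous_of_mem_conePoly (hP : P ∈ conePoly d n) : Continuous P :=
  (contDiff_of_mem_conePoly (k := 0) hP).continuous

theorem harmonicOnNhd_slice_of_mem_conePoly (hP : P ∈ conePoly d n) (t : ℝ) :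
    HarmonicOnNhd (fun x => P (x, t)) Set.univ := by
  induction hP using conePoly_induction with
  | monomial j m p hp => exact (harmonicOnNhd_eval_of_isSolidHarmonic hp).const_smul (c := t ^ j)
  | zero => exact harmonicOnNhd_const 0
  | add P Q _ _ hP hQ => exact hP.add hQ
  | smul c P _ hP => exact hP.const_smul

theorem conePoly_slice_eq_zero_of_eqOn_sphere [NeZero d] (hP : P ∈ conePoly d n) {r t : ℝ}
    (hr : 0 < r) (h : ∀ x : EuclideanSpace ℝ (Fin d), ‖x‖ = r → P (x, t) = 0)
    (x : EuclideanSpace ℝ (Fin d)) : P (x, t) = 0 := by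
  have hanalytic : AnalyticOnNhd ℝ (fun x => P (x, t)) Set.univ :=
    (analyticOnNhd_of_mem_conePoly hP).along_fst
  have hsphere : Set.EqOn (fun x => P (x, t)) 0 (Metric.sphere 0 r) :=
    fun y hy => h y (mem_sphere_zero_iff_norm.1 hy)
  have hslice := eq_zero_of_harmonicOnNhd_of_eqOn_sphere
    (harmonicOnNhd_slice_of_mem_conePoly hP t) hanalytic hr hsphere
  exact congrFun hslice x

end ConePolynomials

section VerticalDerivatives

theorem eq_zero_of_iteratedDeriv_eq_zero {F : Type*} [NormedAddCommGroup F] [NormedSpace ℝ F]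
    {s : ℕ} {g : ℝ → F} (hg : ContDiff ℝ s g) (hs : iteratedDeriv s g = 0) {a : ℝ}
    (ha : ∀ k < s, iteratedDeriv k g a = 0) : g = 0 := by
  induction s with
  | zero => rwa [iteratedDeriv_zero] at hs
  | succ s ih =>
    refine ih (hg.of_le (by norm_cast; omega)) ?_ fun k hk => ha k (by omega)
    ext t
    rw [is_const_of_deriv_eq_zero (hg.differentiable_iteratedDeriv s (by norm_cast; omega))
      (fun v => by rw [← iteratedDeriv_succ, hs, Pi.zero_apply]) t a, ha s (by omega),
      Pi.zero_apply]

variable {d n : ℕ} {P Q : ConeFun d}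

@[simp]
theorem tDeriv_zero_left (f : ConeFun d) : tDeriv 0 f = f := by
  ext z; simp [tDeriv]

@[simp]
theorem tDeriv_zero_right (k : ℕ) : tDeriv k (0 : ConeFun d) = 0 := by
  ext z; simp [tDeriv]

theorem tDeriv_smul (k : ℕ) (c : ℝ) (f : ConeFun d) : tDeriv k (c • f) = c • tDeriv k f :=
  funext fun _ => iteratedDeriv_const_smul_field c _

theorem tDeriv_add {k : ℕ} {f g : ConeFun d} (hf : ContDiff ℝ k f) (hg : ContDiff ℝ k g) :
    tDeriv k (f + g) = tDeriv k f + tDeriv k g :=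
  funext fun z => iteratedDeriv_add (hf.comp (contDiff_prodMk_right z.1)).contDiffAt
    (hg.comp (contDiff_prodMk_right z.1)).contDiffAt

theorem tDeriv_tDeriv_one (k : ℕ) (f : ConeFun d) : tDeriv k (tDeriv 1 f) = tDeriv (k + 1) f := by
  ext z
  simp only [tDeriv, iteratedDeriv_succ', iteratedDeriv_zero]

theorem tDeriv_coneMonomial (k j : ℕ) (p : MvPolynomial (Fin d) ℝ) :
    tDeriv k (coneMonomial j p) = (j.descFactorial k : ℝ) • coneMonomial (j - k) p := by
  ext z
  change iteratedDeriv k (fun v : ℝ => v ^ j * MvPolynomial.eval z.1 p) z.2 =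
    j.descFactorial k * (z.2 ^ (j - k) * MvPolynomial.eval z.1 p)
  simp_rw [mul_comm _ (MvPolynomial.eval _ p), iteratedDeriv_const_mul_field, iteratedDeriv_pow]
  ring

theorem tDeriv_mem_conePoly (hP : P ∈ conePoly d n) (k : ℕ) : tDeriv k P ∈ conePoly d (n - k) := by
  induction hP using conePoly_induction with
  | monomial j m p hp hjm =>
    rw [tDeriv_coneMonomial]
    rcases lt_or_ge j k with hjk | hkj
    · rw [Nat.descFactorial_of_lt hjk, Nat.cast_zero, zero_smul]
      exact Submodule.zero_mem _
    · exact Submodule.smul_mem _ _ (coneMonomial_mem_conePoly hp (by omega))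
  | zero =>
    rw [tDeriv_zero_right]
    exact Submodule.zero_mem _
  | add P Q hP' hQ' hP hQ =>
    rw [tDeriv_add (contDiff_of_mem_conePoly hP') (contDiff_of_mem_conePoly hQ')]
    exact Submodule.add_mem _ hP hQ
  | smul c P _ hP =>
    rw [tDeriv_smul]
    exact Submodule.smul_mem _ c hP

theorem tDeriv_eq_zero_of_lt (hP : P ∈ conePoly d n) {k : ℕ} (hk : n < k) : tDeriv k P = 0 := by
  induction hP using conePoly_induction with
  | monomial j m p hp hjm =>
    rw [tDeriv_coneMonomial, Nat.descFactorial_of_lt (by omega), Nat.cast_zero, zero_smul]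
  | zero => exact tDeriv_zero_right k
  | add P Q hP' hQ' hP hQ =>
    rw [tDeriv_add (contDiff_of_mem_conePoly hP') (contDiff_of_mem_conePoly hQ'), hP, hQ, add_zero]
  | smul c P _ hP => rw [tDeriv_smul, hP, smul_zero]

theorem exists_tDeriv_one_eq (hQ : Q ∈ conePoly d n) :
    ∃ G ∈ conePoly d (n + 1), tDeriv 1 G = Q ∧ ∀ x, G (x, 1) = 0 := by
  induction hQ using conePoly_induction with
  | monomial j m p hp hjm =>
    let G := (j + 1 : ℝ)⁻¹ • (coneMonomial (j + 1) p + (-1 : ℝ) • coneMonomial 0 p)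
    have hsucc := coneMonomial_mem_conePoly hp (show j + 1 + m ≤ n + 1 by omega)
    have hneg : (-1 : ℝ) • coneMonomial 0 p ∈ conePoly d (n + 1) :=
      Submodule.smul_mem _ (-1) (coneMonomial_mem_conePoly hp (by omega))
    have hj : (j : ℝ) + 1 ≠ 0 := by positivity
    refine ⟨G, Submodule.smul_mem _ _ (Submodule.add_mem _ hsucc hneg), ?_,
      fun x => by simp [G, coneMonomial]⟩
    rw [tDeriv_smul, tDeriv_add (contDiff_of_mem_conePoly hsucc) (contDiff_of_mem_conePoly hneg),
      tDeriv_smul, tDeriv_coneMonomial, tDeriv_coneMonomial]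
    simp [smul_smul, hj]
  | zero => exact ⟨0, Submodule.zero_mem _, tDeriv_zero_right 1, fun _ => rfl⟩
  | add P Q _ _ hP hQ =>
    obtain ⟨G, hG, rfl, hG0⟩ := hP
    obtain ⟨H, hH, rfl, hH0⟩ := hQ
    exact ⟨G + H, Submodule.add_mem _ hG hH,
      tDeriv_add (contDiff_of_mem_conePoly hG) (contDiff_of_mem_conePoly hH), by simp [hG0, hH0]⟩
  | smul c P _ hP =>
    obtain ⟨G, hG, rfl, hG0⟩ := hP
    exact ⟨c • G, Submodule.smul_mem _ c hG, tDeriv_smul 1 c G, by simp [hG0]⟩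

theorem exists_tDeriv_eq (s : ℕ) (hQ : Q ∈ conePoly d n) :
    ∃ G ∈ conePoly d (n + s), tDeriv s G = Q ∧ ∀ k < s, ∀ x, tDeriv k G (x, 1) = 0 := by
  induction s with
  | zero => exact ⟨Q, hQ, tDeriv_zero_left Q, by simp⟩
  | succ s ih =>
    obtain ⟨G, hG, rfl, hG0⟩ := ih
    obtain ⟨H, hH, rfl, hH0⟩ := exists_tDeriv_one_eq hG
    refine ⟨H, hH, (tDeriv_tDeriv_one s H).symm, fun k hk x => ?_⟩
    cases k with
    | zero => rw [tDeriv_zero_left, hH0]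
    | succ k => rw [← tDeriv_tDeriv_one, hG0 k (by omega)]

theorem eq_zero_of_tDeriv_eq_zero {s : ℕ} {f : ConeFun d} (hf : ContDiff ℝ s f)
    (hs : tDeriv s f = 0) {t : ℝ} (ht : ∀ k < s, ∀ x, tDeriv k f (x, t) = 0) : f = 0 := by
  ext ⟨x, v⟩
  have hslice := eq_zero_of_iteratedDeriv_eq_zero (hf.comp (contDiff_prodMk_right x))
    (funext fun v => congrFun hs (x, v)) fun k hk => ht k hk x
  exact congrFun hslice v

end VerticalDerivatives

section ConeMeasure

variable {d n : ℕ} {α γ : ℝ} {P : ConeFun d}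

instance isOpenPosMeasure_sphereMeasure (d : ℕ) : (sphereMeasure d).IsOpenPosMeasure :=
  inferInstanceAs (Measure.toSphere _).IsOpenPosMeasure

instance isFiniteMeasure_sphereMeasure (d : ℕ) : IsFiniteMeasure (sphereMeasure d) :=
  inferInstanceAs (IsFiniteMeasure (Measure.toSphere _))

theorem sphereArea_pos (d : ℕ) [NeZero d] : 0 < sphereArea d := by
  have : NeZero (sphereMeasure d) := ⟨Measure.toSphere_ne_zero _⟩
  exact measureReal_univ_pos

/-- The conic surface `{(x, t) : ‖x‖ = t, 0 < t ≤ 1}` without its apex. -/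
def conicSurface (d : ℕ) : Set (EuclideanSpace ℝ (Fin d) × ℝ) :=
  {z | ‖z.1‖ = z.2 ∧ 0 < z.2 ∧ z.2 ≤ 1}

theorem coe_sphere_one_mem_conicSurface (ξ : Metric.sphere (0 : EuclideanSpace ℝ (Fin d)) 1) :
    ((ξ : EuclideanSpace ℝ (Fin d)), (1 : ℝ)) ∈ conicSurface d :=
  ⟨norm_eq_of_mem_sphere ξ, one_pos, le_rfl⟩

theorem measurable_smul_sphere_prodMk : Measurable
    fun p : ℝ × Metric.sphere (0 : EuclideanSpace ℝ (Fin d)) 1 =>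
      (p.1 • (p.2 : EuclideanSpace ℝ (Fin d)), p.1) :=
  Continuous.measurable (by fun_prop)

theorem quasiMeasurePreserving_snd_coneMeasure :
    Measure.QuasiMeasurePreserving Prod.snd (coneMeasure d) (volume.restrict (Set.Ioo 0 1)) := by
  refine ⟨measurable_snd, ?_⟩
  rw [coneMeasure, Measure.map_map measurable_snd measurable_smul_sphere_prodMk,
    ← restrict_Ioo_eq_restrict_Ioc]
  exact Measure.quasiMeasurePreserving_fst.absolutelyContinuous.trans
    (withDensity_absolutelyContinuous _ _)

theorem ae_coneMeasure_norm_fst_eq_abs_snd : ∀ᵐ z ∂coneMeasure d, ‖z.1‖ = |z.2| :=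
  (ae_map_iff measurable_smul_sphere_prodMk.aemeasurable
    (measurableSet_eq_fun measurable_fst.norm measurable_snd.abs)).2
    (.of_forall fun p => by simp [norm_smul])

theorem ae_coneMeasure_snd_mem_Ioo : ∀ᵐ z ∂coneMeasure d, z.2 ∈ Set.Ioo 0 1 :=
  quasiMeasurePreserving_snd_coneMeasure.ae (ae_restrict_mem measurableSet_Ioo)

theorem ae_mem_conicSurface : ∀ᵐ z ∂coneMeasure d, z ∈ conicSurface d := by
  filter_upwards [ae_coneMeasure_norm_fst_eq_abs_snd, ae_coneMeasure_snd_mem_Ioo] with z hz ht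
  exact ⟨hz.trans (abs_of_pos ht.1), ht.1, ht.2.le⟩

theorem ae_ae_sphere_of_ae_coneMeasure {p : EuclideanSpace ℝ (Fin d) × ℝ → Prop}
    (h : ∀ᵐ z ∂coneMeasure d, p z) : ∀ᵐ t ∂volume.restrict (Set.Ioo (0 : ℝ) 1),
      ∀ᵐ ξ : Metric.sphere (0 : EuclideanSpace ℝ (Fin d)) 1 ∂sphereMeasure d,
        p (t • (ξ : EuclideanSpace ℝ (Fin d)), t) := by
  have hprod := Measure.ae_ae_of_ae_prod
    (ae_of_ae_map measurable_smul_sphere_prodMk.aemeasurable h)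
  rw [ae_withDensity_iff (by fun_prop), ← restrict_Ioo_eq_restrict_Ioc] at hprod
  filter_upwards [hprod, ae_restrict_mem measurableSet_Ioo] with t ht ht0
  exact ht (by simpa using pow_pos ht0.1 _)

theorem lintegral_coneMeasure_comp_snd {g : ℝ → ENNReal} (hg : Measurable g) :
    ∫⁻ z, g z.2 ∂coneMeasure d =
      (∫⁻ t in Set.Ioo 0 1, ENNReal.ofReal (t ^ (d - 1)) * g t) * sphereMeasure d Set.univ := by
  rw [coneMeasure, lintegral_map (by fun_prop) measurable_smul_sphere_prodMk,
    ← restrict_Ioo_eq_restrict_Ioc]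
  have hprod := lintegral_prod_mul (μ := ((volume : Measure ℝ).restrict (Set.Ioo 0 1)).withDensity
    fun t => ENNReal.ofReal (t ^ (d - 1))) (ν := sphereMeasure d) hg.aemeasurable
    (aemeasurable_const (b := 1))
  simp only [mul_one, lintegral_const, one_mul] at hprod
  rw [hprod, lintegral_withDensity_eq_lintegral_mul _ (by fun_prop) hg]
  rfl

@[fun_prop]
theorem measurable_jacobiWeight : Measurable (jacobiWeight α γ) :=
  (measurable_id.pow_const α).mul ((measurable_const.sub measurable_id).pow_const γ)

theorem jacobiWeight_pos {t : ℝ} (ht : t ∈ Set.Ioo 0 1) : 0 < jacobiWeight α γ t :=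
  mul_pos (Real.rpow_pos_of_pos ht.1 α) (Real.rpow_pos_of_pos (sub_pos.2 ht.2) γ)

@[simp]
theorem jacobiWeight_zero_right (t : ℝ) : jacobiWeight α 0 t = t ^ α := by
  simp [jacobiWeight]

theorem pow_mul_jacobiWeight (k : ℕ) {t : ℝ} (ht : 0 < t) :
    t ^ k * jacobiWeight α γ t = jacobiWeight (α + k) γ t := by
  rw [jacobiWeight, jacobiWeight, Real.rpow_add_natCast ht.ne']
  ring

theorem setLIntegral_jacobiWeight (hα : -1 < α) (hγ : -1 < γ) :
    ∫⁻ t in Set.Ioo 0 1, ENNReal.ofReal (jacobiWeight α γ t) =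
      ENNReal.ofReal (ProbabilityTheory.beta (α + 1) (γ + 1)) := by
  have hbeta : 0 < ProbabilityTheory.beta (α + 1) (γ + 1) :=
    ProbabilityTheory.beta_pos (by linarith) (by linarith)
  rw [← mul_one (ENNReal.ofReal (ProbabilityTheory.beta _ _)),
    ← ProbabilityTheory.lintegral_betaPDF_eq_one (show 0 < α + 1 by linarith)
      (show 0 < γ + 1 by linarith), ProbabilityTheory.lintegral_betaPDF,
    ← lintegral_const_mul' _ _ ENNReal.ofReal_ne_top]
  refine lintegral_congr fun t => ?_
  rw [← ENNReal.ofReal_mul hbeta.le, jacobiWeight, add_sub_cancel_right, add_sub_cancel_right]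
  field_simp

/-- The measure `w_{α,γ} dm` on the conic surface, for the Jacobi weight `w_{α,γ}`. -/
def weightedConeMeasure (d : ℕ) (α γ : ℝ) : Measure (EuclideanSpace ℝ (Fin d) × ℝ) :=
  (coneMeasure d).withDensity fun z => ENNReal.ofReal (jacobiWeight α γ z.2)

theorem weightedConeMeasure_absolutelyContinuous :
    weightedConeMeasure d α γ ≪ coneMeasure d :=
  withDensity_absolutelyContinuous _ _

theorem coneMeasure_absolutelyContinuous : coneMeasure d ≪ weightedConeMeasure d α γ := by
  refine withDensity_absolutelyContinuous' (by fun_prop) ?_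
  filter_upwards [ae_coneMeasure_snd_mem_Ioo] with z hz
  simpa using jacobiWeight_pos hz

theorem integral_mul_jacobiWeight_coneMeasure (g : ConeFun d) :
    ∫ z, g z * jacobiWeight α γ z.2 ∂coneMeasure d = ∫ z, g z ∂weightedConeMeasure d α γ := by
  rw [weightedConeMeasure, integral_withDensity_eq_integral_toReal_smul (by fun_prop)
    (by simp)]
  refine integral_congr_ae ?_
  filter_upwards [ae_coneMeasure_snd_mem_Ioo] with z hz
  rw [ENNReal.toReal_ofReal (jacobiWeight_pos hz).le, smul_eq_mul, mul_comm]

theorem isFiniteMeasure_weightedConeMeasure [NeZero d] (hα : -(d : ℝ) < α) (hγ : -1 < γ) :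
    IsFiniteMeasure (weightedConeMeasure d α γ) := by
  have hd : ((d - 1 : ℕ) : ℝ) = d - 1 := by rw [Nat.cast_sub NeZero.one_le, Nat.cast_one]
  have hweight : ∫⁻ t in Set.Ioo 0 1, ENNReal.ofReal (t ^ (d - 1)) *
      ENNReal.ofReal (jacobiWeight α γ t) < ⊤ := by
    calc
      _ = ∫⁻ t in Set.Ioo 0 1, ENNReal.ofReal (jacobiWeight (α + (d - 1 : ℕ)) γ t) :=
        setLIntegral_congr_fun measurableSet_Ioo fun t ht => by
          simp only [← ENNReal.ofReal_mul (pow_nonneg ht.1.le _), pow_mul_jacobiWeight _ ht.1]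
      _ = _ := setLIntegral_jacobiWeight (by rw [hd]; linarith) hγ
      _ < ⊤ := ENNReal.ofReal_lt_top
  constructor
  rw [weightedConeMeasure, withDensity_apply _ MeasurableSet.univ, Measure.restrict_univ,
    lintegral_coneMeasure_comp_snd measurable_jacobiWeight.ennreal_ofReal]
  exact ENNReal.mul_lt_top hweight (measure_lt_top _ _)

theorem memLp_weightedConeMeasure_of_mem_conePoly [NeZero d] (hα : -(d : ℝ) < α) (hγ : -1 < γ)
    (hP : P ∈ conePoly d n) : MemLp P 2 (weightedConeMeasure d α γ) := by
  have := isFiniteMeasure_weightedConeMeasure hα hγ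
  have hcont := continuous_of_mem_conePoly hP
  obtain ⟨C, hC⟩ := ((isCompact_closedBall (0 : EuclideanSpace ℝ (Fin d)) 1).prod
    (isCompact_Icc (a := (0 : ℝ)) (b := 1))).exists_bound_of_continuousOn hcont.continuousOn
  refine .of_bound hcont.aestronglyMeasurable C ?_
  filter_upwards [weightedConeMeasure_absolutelyContinuous.ae_le ae_mem_conicSurface]
    with z ⟨hz, ht0, ht1⟩
  exact hC z ⟨by simpa [hz] using ht1, ht0.le, ht1⟩

theorem eq_zero_of_ae_coneMeasure_eq_zero [NeZero d] (hP : P ∈ conePoly d n)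
    (h : P =ᵐ[coneMeasure d] 0) : P = 0 := by
  have hslice : ∀ᵐ t ∂volume.restrict (Set.Ioo (0 : ℝ) 1), ∀ x, P (x, t) = 0 := by
    filter_upwards [ae_ae_sphere_of_ae_coneMeasure h, ae_restrict_mem measurableSet_Ioo]
      with t hae ht
    have hcont : Continuous fun ξ : Metric.sphere (0 : EuclideanSpace ℝ (Fin d)) 1 =>
        P (t • (ξ : EuclideanSpace ℝ (Fin d)), t) :=
      (continuous_of_mem_conePoly hP).comp (by fun_prop)
    have hzero := (hcont.ae_eq_iff_eq (sphereMeasure d) (continuous_const (y := 0))).1 hae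
    refine conePoly_slice_eq_zero_of_eqOn_sphere hP ht.1 fun x hx => ?_
    have hmem : t⁻¹ • x ∈ Metric.sphere (0 : EuclideanSpace ℝ (Fin d)) 1 := by
      simp [norm_smul, hx, abs_of_pos ht.1, ht.1.ne']
    simpa [smul_smul, ht.1.ne'] using congrFun hzero ⟨t⁻¹ • x, hmem⟩
  ext ⟨x, t⟩
  have hanalytic : AnalyticOnNhd ℝ (fun t => P (x, t)) Set.univ :=
    (analyticOnNhd_of_mem_conePoly hP).along_snd
  have hIoo : Set.EqOn (fun t => P (x, t)) 0 (Set.Ioo 0 1) :=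
    Measure.eqOn_open_of_ae_eq (hslice.mono fun t ht => ht x) isOpen_Ioo
      (hanalytic.continuousOn.mono (Set.subset_univ _)) continuousOn_const
  have hzero := hanalytic.eq_of_eventuallyEq analyticOnNhd_const
    (hIoo.eventuallyEq_of_mem (Ioo_mem_nhds one_half_pos one_half_lt_one))
  exact congrFun hzero t

theorem eq_zero_of_integral_weightedConeMeasure_mul_self_eq_zero [NeZero d] (hα : -(d : ℝ) < α)
    (hγ : -1 < γ) (hP : P ∈ conePoly d n)
    (h : ∫ z, P z * P z ∂weightedConeMeasure d α γ = 0) : P = 0 :=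
  eq_zero_of_ae_coneMeasure_eq_zero hP <| coneMeasure_absolutelyContinuous.ae_le <|
    ae_eq_zero_of_integral_mul_self_eq_zero
      (memLp_weightedConeMeasure_of_mem_conePoly hα hγ hP) h

end ConeMeasure

section ConeProjection

variable {d n : ℕ} {α γ : ℝ} {f : ConeFun d}

theorem coneInner_eq (f g : ConeFun d) : coneInner α γ f g =
    coneConst d α γ * ∫ z, f z * g z ∂weightedConeMeasure d α γ := by
  rw [coneInner, integral_mul_jacobiWeight_coneMeasure]

theorem coneInner_comm (f g : ConeFun d) : coneInner α γ f g = coneInner α γ g f := by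
  simp only [coneInner, mul_comm]

theorem coneConst_pos [NeZero d] (hα : -(d : ℝ) < α) (hγ : -1 < γ) : 0 < coneConst d α γ := by
  have h₁ := Real.Gamma_pos_of_pos (show 0 < α + d by linarith)
  have h₂ := Real.Gamma_pos_of_pos (show 0 < γ + 1 by linarith)
  have h₃ := Real.Gamma_pos_of_pos (show 0 < α + γ + d + 1 by linarith)
  have h₄ := sphereArea_pos d
  unfold coneConst
  positivity

/-- The functions in `L²` of the conic surface with the Jacobi weight `w_{α,γ}`, as functions
rather than classes modulo null sets. -/
def coneL2 (d : ℕ) (α γ : ℝ) : Submodule ℝ (ConeFun d) where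
  carrier := {f | MemL2Cone α γ f}
  add_mem' hf hg := MemLp.add hf hg
  zero_mem' := MemLp.zero
  smul_mem' c _ hf := MemLp.const_smul hf c

theorem isBilinOn_coneInner : IsBilinOn (coneInner α γ) (coneL2 d α γ) := by
  rw [funext₂ coneInner_eq]
  exact (isBilinOn_integral_mul (T := id) (fun _ hf => hf) (fun _ _ _ _ => .rfl)
    fun _ _ _ => .rfl).const_mul (coneConst d α γ)

theorem conePoly_le_coneL2 [NeZero d] (hα : -(d : ℝ) < α) (hγ : -1 < γ) (n : ℕ) :
    conePoly d n ≤ coneL2 d α γ :=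
  fun _ hP => memLp_weightedConeMeasure_of_mem_conePoly hα hγ hP

theorem existsUnique_isConeProj [NeZero d] (hα : -(d : ℝ) < α) (hγ : -1 < γ) (n : ℕ)
    (hf : MemL2Cone α γ f) : ∃! P, IsConeProj α γ n f P := by
  refine isBilinOn_coneInner.existsUnique_isOrthProj (conePoly_le_coneL2 hα hγ)
    (fun P hP h => ?_) hf
  rw [coneInner_eq] at h
  exact eq_zero_of_integral_weightedConeMeasure_mul_self_eq_zero hα hγ hP
    ((mul_eq_zero.1 h).resolve_left (coneConst_pos hα hγ).ne')

end ConeProjection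

section SobolevSpace

theorem iteratedDeriv_add_of_differentiableAt {𝕜 F : Type*} [NontriviallyNormedField 𝕜]
    [NormedAddCommGroup F] [NormedSpace 𝕜 F] {S : Set 𝕜} (hS : IsOpen S) {s : ℕ} {f g : 𝕜 → F}
    (hf : ∀ v ∈ S, ∀ k < s, DifferentiableAt 𝕜 (iteratedDeriv k f) v)
    (hg : ∀ v ∈ S, ∀ k < s, DifferentiableAt 𝕜 (iteratedDeriv k g) v) {k : ℕ} (hk : k ≤ s) :
    Set.EqOn (iteratedDeriv k (f + g)) (iteratedDeriv k f + iteratedDeriv k g) S := by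
  induction k with
  | zero => exact fun v _ => by simp
  | succ k ih =>
    intro v hv
    have hnear := (ih (by omega)).eventuallyEq_of_mem (hS.mem_nhds hv)
    rw [Pi.add_apply, iteratedDeriv_succ, iteratedDeriv_succ, iteratedDeriv_succ, hnear.deriv_eq,
      deriv_add (hf v hv k (by omega)) (hg v hv k (by omega))]

namespace TDifferentiableNearCone

variable {d s : ℕ} {f g : ConeFun d}

theorem tDeriv_add (hf : TDifferentiableNearCone s f) (hg : TDifferentiableNearCone s g) {k : ℕ}
    (hk : k ≤ s) : Set.EqOn (tDeriv k (f + g)) (tDeriv k f + tDeriv k g) (conicSurface d) := by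
  obtain ⟨U, hU, hUc, hUf⟩ := hf
  obtain ⟨V, hV, hVc, hVg⟩ := hg
  intro z ⟨hz, ht0, ht1⟩
  exact iteratedDeriv_add_of_differentiableAt ((hU.inter hV).preimage (.prodMk_right z.1))
    (fun v hv => hUf (z.1, v) hv.1) (fun v hv => hVg (z.1, v) hv.2) hk
    ⟨hUc z hz ht0 ht1, hVc z hz ht0 ht1⟩

theorem add (hf : TDifferentiableNearCone s f) (hg : TDifferentiableNearCone s g) :
    TDifferentiableNearCone s (f + g) := by
  obtain ⟨U, hU, hUc, hUf⟩ := hf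
  obtain ⟨V, hV, hVc, hVg⟩ := hg
  refine ⟨U ∩ V, hU.inter hV, fun z hz ht0 ht1 => ⟨hUc z hz ht0 ht1, hVc z hz ht0 ht1⟩,
    fun z hz k hk => ?_⟩
  have hopen : IsOpen {v : ℝ | (z.1, v) ∈ U ∩ V} := (hU.inter hV).preimage (.prodMk_right z.1)
  exact ((hUf z hz.1 k hk).add (hVg z hz.2 k hk)).congr_of_eventuallyEq <|
    (iteratedDeriv_add_of_differentiableAt hopen (fun v hv => hUf (z.1, v) hv.1)
      (fun v hv => hVg (z.1, v) hv.2) hk.le).eventuallyEq_of_mem (hopen.mem_nhds hz)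

theorem const_smul (c : ℝ) (hf : TDifferentiableNearCone s f) :
    TDifferentiableNearCone s (c • f) := by
  obtain ⟨U, hU, hUc, hUf⟩ := hf
  refine ⟨U, hU, hUc, fun z hz k hk => ?_⟩
  have hslice : iteratedDeriv k (fun v => (c • f) (z.1, v)) =
      c • iteratedDeriv k fun v => f (z.1, v) :=
    funext fun v => iteratedDeriv_const_smul_field c _
  exact hslice ▸ (hUf z hz k hk).const_smul c

theorem of_contDiff (hf : ContDiff ℝ s f) : TDifferentiableNearCone s f :=
  ⟨Set.univ, isOpen_univ, fun _ _ _ _ => trivial, fun z _ k hk =>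
    (hf.comp (contDiff_prodMk_right z.1)).differentiable_iteratedDeriv k (by norm_cast) z.2⟩

end TDifferentiableNearCone

variable {d n s : ℕ} {α : ℝ} {f g P : ConeFun d}

/-- The restriction of `∂_t^k f` to the rim `t = 1` of the conic surface. -/
def rimTrace (k : ℕ) (f : ConeFun d) : Metric.sphere (0 : EuclideanSpace ℝ (Fin d)) 1 → ℝ :=
  fun ξ => tDeriv k f ((ξ : EuclideanSpace ℝ (Fin d)), 1)

theorem rimTrace_zero (k : ℕ) : rimTrace k (0 : ConeFun d) = 0 := by
  ext ξ
  simp [rimTrace]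

theorem rimTrace_add (hf : TDifferentiableNearCone s f) (hg : TDifferentiableNearCone s g) {k : ℕ}
    (hk : k ≤ s) : rimTrace k (f + g) = rimTrace k f + rimTrace k g :=
  funext fun ξ => hf.tDeriv_add hg hk (coe_sphere_one_mem_conicSurface ξ)

theorem rimTrace_smul (k : ℕ) (c : ℝ) (f : ConeFun d) : rimTrace k (c • f) = c • rimTrace k f := by
  ext ξ
  simp [rimTrace, tDeriv_smul]

theorem continuous_rimTrace (hP : P ∈ conePoly d n) (k : ℕ) : Continuous (rimTrace k P) :=
  (continuous_of_mem_conePoly (tDeriv_mem_conePoly hP k)).comp (by fun_prop)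

theorem memLp_rimTrace (hP : P ∈ conePoly d n) (k : ℕ) :
    MemLp (rimTrace k P) 2 (sphereMeasure d) :=
  (continuous_rimTrace hP k).memLp_of_hasCompactSupport (.of_compactSpace _)

theorem tDeriv_add_ae (hf : TDifferentiableNearCone s f) (hg : TDifferentiableNearCone s g)
    (α : ℝ) : tDeriv s (f + g) =ᵐ[weightedConeMeasure d α 0] tDeriv s f + tDeriv s g := by
  filter_upwards [weightedConeMeasure_absolutelyContinuous.ae_le ae_mem_conicSurface]
    with z hz using hf.tDeriv_add hg le_rfl hz

/-- The functions admitted as arguments of the Sobolev inner product whose integral over the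
conic surface carries the weight `t ^ α`. -/
def sobolevSpace (d s : ℕ) (α : ℝ) : Submodule ℝ (ConeFun d) where
  carrier := {f | TDifferentiableNearCone s f ∧
    (∀ k < s, MemLp (rimTrace k f) 2 (sphereMeasure d)) ∧ MemL2Cone α 0 (tDeriv s f)}
  add_mem' := fun ⟨hf, hfr, hfi⟩ ⟨hg, hgr, hgi⟩ => ⟨hf.add hg,
    fun k hk => rimTrace_add hf hg hk.le ▸ (hfr k hk).add (hgr k hk),
    (MemLp.add hfi hgi).ae_eq (tDeriv_add_ae hf hg α).symm⟩
  zero_mem' := ⟨.of_contDiff contDiff_const, fun k _ => rimTrace_zero (d := d) k ▸ MemLp.zero,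
    by rw [tDeriv_zero_right]; exact MemLp.zero⟩
  smul_mem' := fun c f ⟨hf, hfr, hfi⟩ => ⟨hf.const_smul c,
    fun k hk => rimTrace_smul k c f ▸ (hfr k hk).const_smul c,
    tDeriv_smul s c f ▸ MemLp.const_smul hfi c⟩

theorem conePoly_le_sobolevSpace [NeZero d] (s : ℕ) (hα : -(d : ℝ) < α) (n : ℕ) :
    conePoly d n ≤ sobolevSpace d s α := fun _ hP =>
  ⟨.of_contDiff (contDiff_of_mem_conePoly hP), fun k _ => memLp_rimTrace hP k,
    conePoly_le_coneL2 hα neg_one_lt_zero _ (tDeriv_mem_conePoly hP s)⟩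

end SobolevSpace

section SobolevProjection

variable {d n s : ℕ} {β : ℝ} {lam : ℕ → ℝ} {f P : ConeFun d}

theorem sobolevInner_eq (f g : ConeFun d) : sobolevInner s β lam f g =
    1 / sphereArea d * (∫ z, tDeriv s f z * tDeriv s g z ∂weightedConeMeasure d (β + s) 0) +
      ∑ k ∈ Finset.range s, lam k / sphereArea d *
        ∫ ξ, rimTrace k f ξ * rimTrace k g ξ ∂sphereMeasure d := by
  simp only [sobolevInner, ← integral_mul_jacobiWeight_coneMeasure, jacobiWeight_zero_right,
    rimTrace]

theorem sobolevInner_comm (f g : ConeFun d) :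
    sobolevInner s β lam f g = sobolevInner s β lam g f := by
  simp only [sobolevInner, mul_comm]

theorem isBilinOn_sobolevInner :
    IsBilinOn (sobolevInner s β lam) (sobolevSpace d s (β + s)) := by
  rw [funext₂ sobolevInner_eq]
  have hcone := isBilinOn_integral_mul (A := sobolevSpace d s (β + s)) (T := tDeriv s)
    (fun f hf => hf.2.2) (fun f hf g hg => tDeriv_add_ae hf.1 hg.1 (β + s))
    (fun c f _ => .of_eq (tDeriv_smul s c f))
  have hrim (k) (hk : k < s) := isBilinOn_integral_mul (A := sobolevSpace d s (β + s))
    (T := rimTrace k) (fun f hf => hf.2.1 k hk)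
    (fun f hf g hg => .of_eq (rimTrace_add hf.1 hg.1 hk.le))
    (fun c f _ => .of_eq (rimTrace_smul k c f))
  exact (hcone.const_mul _).add (.sum fun k hk => (hrim k (Finset.mem_range.1 hk)).const_mul _)

theorem eq_zero_of_sobolevInner_self_eq_zero [NeZero d] (hβ : -(d : ℝ) < β + s)
    (hlam : ∀ k < s, 0 < lam k) (hP : P ∈ conePoly d n) (h : sobolevInner s β lam P P = 0) :
    P = 0 := by
  have hω := sphereArea_pos d
  have hterm : ∀ k ∈ Finset.range s, 0 ≤ lam k / sphereArea d *
      ∫ ξ, rimTrace k P ξ * rimTrace k P ξ ∂sphereMeasure d := fun k hk =>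
    mul_nonneg (div_pos (hlam k (Finset.mem_range.1 hk)) hω).le
      (integral_nonneg fun ξ => mul_self_nonneg _)
  rw [sobolevInner_eq, add_eq_zero_iff_of_nonneg (mul_nonneg (one_div_pos.2 hω).le
    (integral_nonneg fun z => mul_self_nonneg _)) (Finset.sum_nonneg hterm),
    Finset.sum_eq_zero_iff_of_nonneg hterm] at h
  have hderiv : tDeriv s P = 0 := eq_zero_of_integral_weightedConeMeasure_mul_self_eq_zero hβ
    neg_one_lt_zero (tDeriv_mem_conePoly hP s)
    ((mul_eq_zero.1 h.1).resolve_left (one_div_pos.2 hω).ne')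
  refine eq_zero_of_tDeriv_eq_zero (contDiff_of_mem_conePoly hP) hderiv (t := 1) fun k hk => ?_
  have hae : rimTrace k P =ᵐ[sphereMeasure d] 0 :=
    ae_eq_zero_of_integral_mul_self_eq_zero (memLp_rimTrace hP k)
      ((mul_eq_zero.1 (h.2 k (Finset.mem_range.2 hk))).resolve_left (div_pos (hlam k hk) hω).ne')
  have hrim := ((continuous_rimTrace hP k).ae_eq_iff_eq (sphereMeasure d) continuous_zero).1 hae
  exact conePoly_slice_eq_zero_of_eqOn_sphere (tDeriv_mem_conePoly hP k) one_pos fun x hx =>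
    congrFun hrim ⟨x, mem_sphere_zero_iff_norm.2 hx⟩

theorem existsUnique_isSobolevProj [NeZero d] (hβ : -(d : ℝ) < β + s)
    (hlam : ∀ k < s, 0 < lam k) (n : ℕ) (hf : f ∈ sobolevSpace d s (β + s)) :
    ∃! P, IsSobolevProj s β lam n f P :=
  isBilinOn_sobolevInner.existsUnique_isOrthProj (conePoly_le_sobolevSpace s hβ)
    (fun _ hP h => eq_zero_of_sobolevInner_self_eq_zero hβ hlam hP h) hf

end SobolevProjection

section Intertwining

variable {d n s : ℕ} [NeZero d] {β : ℝ} {lam : ℕ → ℝ} {f P Q : ConeFun d}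

theorem coneInner_tDeriv_eq (β : ℝ) (lam : ℕ → ℝ) (f : ConeFun d) {G : ConeFun d}
    (hG : ∀ k < s, ∀ x, tDeriv k G (x, 1) = 0) :
    coneInner (β + s) 0 (tDeriv s f) (tDeriv s G) =
      coneConst d (β + s) 0 * sphereArea d * sobolevInner s β lam f G := by
  have hrim : ∀ k ∈ Finset.range s, lam k / sphereArea d *
      ∫ ξ, rimTrace k f ξ * rimTrace k G ξ ∂sphereMeasure d = 0 := fun k hk => by
    simp [rimTrace, hG k (Finset.mem_range.1 hk)]
  have hω := (sphereArea_pos d).ne'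
  rw [sobolevInner_eq, Finset.sum_eq_zero hrim, add_zero, coneInner_eq]
  field_simp

theorem tDeriv_mem_orthPoly (hn : s ≤ n) (hP : P ∈ orthPoly (sobolevInner s β lam) n) :
    tDeriv s P ∈ orthPoly (coneInner (β + s) 0) (n - s) := by
  refine ⟨tDeriv_mem_conePoly hP.1 s, fun k hk q hq => ?_⟩
  obtain ⟨G, hG, rfl, hG0⟩ := exists_tDeriv_eq s hq
  rw [coneInner_tDeriv_eq β lam P hG0, hP.2 (k + s) (by omega) G hG, mul_zero]

theorem exists_mem_orthPoly_tDeriv_eq (hβ : -(d : ℝ) < β + s) (hn : s ≤ n)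
    (hQ : Q ∈ orthPoly (coneInner (β + s) 0) (n - s)) :
    ∃ G ∈ orthPoly (sobolevInner s β lam) n, tDeriv s G = Q ∧
      ∀ k < s, ∀ x, tDeriv k G (x, 1) = 0 := by
  obtain ⟨G, hG, rfl, hG0⟩ := exists_tDeriv_eq s hQ.1
  rw [Nat.sub_add_cancel hn] at hG
  refine ⟨G, ⟨hG, fun k hk q hq => ?_⟩, rfl, hG0⟩
  have hconst : coneConst d (β + s) 0 * sphereArea d ≠ 0 :=
    (mul_pos (coneConst_pos hβ neg_one_lt_zero) (sphereArea_pos d)).ne'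
  have horth : coneInner (β + s) 0 (tDeriv s q) (tDeriv s G) = 0 := by
    rcases lt_or_ge k s with hks | hsk
    · rw [tDeriv_eq_zero_of_lt hq hks,
        isBilinOn_coneInner.zero_left (conePoly_le_coneL2 hβ neg_one_lt_zero _ hQ.1)]
    · rw [coneInner_comm]
      exact hQ.2 (k - s) (by omega) _ (tDeriv_mem_conePoly hq s)
  rw [coneInner_tDeriv_eq β lam q hG0, sobolevInner_comm] at horth
  exact (mul_eq_zero.1 horth).resolve_left hconst

theorem isConeProj_tDeriv (hβ : -(d : ℝ) < β + s) (hn : s ≤ n)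
    (hf : f ∈ sobolevSpace d s (β + s)) (hP : IsSobolevProj s β lam n f P) :
    IsConeProj (β + s) 0 (n - s) (tDeriv s f) (tDeriv s P) := by
  refine ⟨tDeriv_mem_orthPoly hn hP.1, fun Q hQ => ?_⟩
  obtain ⟨G, hG, rfl, hG0⟩ := exists_mem_orthPoly_tDeriv_eq (lam := lam) hβ hn hQ
  have hPmem := conePoly_le_sobolevSpace s hβ n hP.1.1
  have hGmem := conePoly_le_sobolevSpace s hβ n hG.1
  have horth := hP.2 G hG
  rw [isBilinOn_sobolevInner.sub_left hf hPmem hGmem] at horth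
  rw [isBilinOn_coneInner.sub_left hf.2.2 hPmem.2.2 hGmem.2.2, coneInner_tDeriv_eq β lam f hG0,
    coneInner_tDeriv_eq β lam P hG0, ← mul_sub, horth, mul_zero]

end Intertwining

end

theorem mainTheorem5 (d : ℕ) (hd : 1 ≤ d) (s : ℕ) (hs : 1 ≤ s) (β : ℝ)
    (hβ : -(d : ℝ) - (s : ℝ) < β) (lam : ℕ → ℝ) (hlam : ∀ k < s, 0 < lam k)
    (f : ConeFun d) (hf : TDifferentiableNearCone s f)
    (hrim : ∀ k < s, MemLp (fun ξ : Metric.sphere (0 : EuclideanSpace ℝ (Fin d)) 1 =>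
      tDeriv k f ((ξ : EuclideanSpace ℝ (Fin d)), 1)) 2 (sphereMeasure d))
    (hL2 : MemL2Cone (β + (s : ℝ)) 0 (tDeriv s f))
    (n : ℕ) (hn : s ≤ n) :
    (∃! P : ConeFun d, IsSobolevProj s β lam n f P) ∧
      (∃! Q : ConeFun d, IsConeProj (β + (s : ℝ)) 0 (n - s) (tDeriv s f) Q) ∧
      ∀ P Q : ConeFun d, IsSobolevProj s β lam n f P →
        IsConeProj (β + (s : ℝ)) 0 (n - s) (tDeriv s f) Q → tDeriv s P = Q := by
  have : NeZero d := ⟨by omega⟩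
  have hα : -(d : ℝ) < β + s := by linarith
  have hfA : f ∈ sobolevSpace d s (β + s) := ⟨hf, hrim, hL2⟩
  have hQ := existsUnique_isConeProj hα neg_one_lt_zero (n - s) hL2
  exact ⟨existsUnique_isSobolevProj hα hlam n hfA, hQ,
    fun P Q hPp hQp => hQ.unique (isConeProj_tDeriv hα hn hfA hPp) hQp⟩
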